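/- Let $\mathbb I=[0,1]$, $\Sigma_2^+=\{1,2\}^{\mathbb N}$ and $\Sigma_2=\{1,2\}^{\mathbb Z}$, with left shifts $\sigma$ and with the Bernoulli measures $\mathbb P^+$ and $\mathbb P$ giving each symbol probability $1/2$. For $\beta_1,\beta_2\in(0,1)$ put $$g_1(y)=y+y(1-y)(y-\beta_1),\qquad g_2(y)=y-y(1-y)(y-\beta_2)\qquad(y\in\mathbb I),$$ let $G^+:\Sigma_2^+\times\mathbb I\to\Sigma_2^+\times\mathbb I$, $G^+(\omega,y)=(\sigma\omega,g_{\omega_0}(y))$, and $g_\omega^n=g_{\omega_{n-1}}\circ\dots\circ g_{\omega_0}$ (also for $\omega\in\Sigma_2$). Let $s=\mathbb P^+\times\mathrm{Leb}$ be the standard measure, $\mathbb A_i=\Sigma_2^+\times\{i\}$ for $i=0,1$, and $\mathcal B(\mathbb A_i)=\{(\omega,y): d((G^+)^n(\omega,y),\mathbb A_i)\to0\}$, where $d$ is the maximum of the distance on $\mathbb I$ and of the distance $2^{-\min\{n:\omega_n\ne\omega'_n\}}$ on $\Sigma_2^+$. A compact set $A$ with $G^+(A)=A$ is called a Milnor attractor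 if the set of points whose $\omega$-limit set is contained in $A$ has non-zero $s$-measure, and no proper compact subset $A'\subsetneq A$ has the same such set up to $s$-measure zero. Let $$\Gamma_S=\Big\{(\beta_1,\beta_2)\in(0,1)^2:\ 2-\tfrac1{\beta_1}<\beta_2<\tfrac1{1-\beta_1}-1\Big\}$$ (the region where both normal exponents $\tfrac12\ln(1-\beta_1)+\tfrac12\ln(1+\beta_2)$ at $0$ and $\tfrac12\ln\beta_1+\tfrac12\ln(2-\beta_2)$ at $1$ are negative). **Theorem.** Let $(\beta_1,\beta_2)\in\Gamma_S$. Then $\mathbb A_0$ and $\mathbb A_1$ are Milnor attractors for $G^+$, and $s(\mathcal B(\mathbb A_0))>0$, $s(\mathcal B(\mathbb A_1))>0$. If moreover $\beta_1\neq\beta_2$, then $\mathcal B(\mathbb A_0)\cup\mathcal B(\mathbb A_1)$ has full $s$-measure, and there is a measurable function $\psi:\Sigma_2\to\mathbb I$ whose graph is invariant, $\psi(\sigma\omega)=g_{\omega_0}(\psi(\omega))$ for all $\omega\in\Sigma_2$, and which separates the basins: for $\mathbb P$-almost every $\omega$ and all $y\in\mathbb I$, $$\lim_{n\to\infty}g_\omega^n(y)=\begin{cases}0&\text{if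 }y<\psi(\omega),\\1&\text{if }y>\psi(\omega).\end{cases}$$ -/

import Mathlib

open MeasureTheory Filter Topology Set
open scoped unitInterval

namespace StepSkew

/-! ### The base: one-sided and two-sided Bernoulli shifts on two symbols

The alphabet `{1, 2}` is `Fin 2`: the first symbol is `0 : Fin 2`, the second is `1 : Fin 2`. -/

/-- One-sided sequences of two symbols, with the product topology and sigma-algebra. -/
abbrev SigmaPlus : Type := ℕ → Fin 2

/-- Two-sided sequences of two symbols, with the product topology and sigma-algebra. -/
abbrev SigmaTwo : Type := ℤ → Fin 2

/-- The left shift on one-sided sequences. -/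
def shiftPlus (ω : SigmaPlus) : SigmaPlus := fun n => ω (n + 1)

/-- The left shift on two-sided sequences. -/
def shiftTwo (ω : SigmaTwo) : SigmaTwo := fun n => ω (n + 1)

/-- The natural projection from two-sided to one-sided sequences. -/
def proj (ω : SigmaTwo) : SigmaPlus := fun n => ω (n : ℤ)

/-- Both symbols have probability `1/2`. -/
noncomputable def symbolMeasure : Measure (Fin 2) := (PMF.uniformOfFintype (Fin 2)).toMeasure

/-- The Bernoulli measure on one-sided sequences. -/
noncomputable def bernoulliPlus : Measure SigmaPlus :=
  Measure.infinitePi fun _ : ℕ => symbolMeasure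

/-- The Bernoulli measure on two-sided sequences. -/
noncomputable def bernoulliTwo : Measure SigmaTwo :=
  Measure.infinitePi fun _ : ℤ => symbolMeasure

/-- The standard measure: Bernoulli measure times Lebesgue measure on `[0,1]`. -/
noncomputable def standardMeasure : Measure (SigmaPlus × I) :=
  bernoulliPlus.prod (volume : Measure I)

/-! ### The cubic fiber maps and the step skew product -/

/-- The cubic maps `y + y(1-y)(y-b)` (first symbol) and `y - y(1-y)(y-b)` (second symbol). -/
noncomputable def cubic : Fin 2 → ℝ → ℝ → ℝ
  | 0, b, y => y + y * (1 - y) * (y - b)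
  | 1, b, y => y - y * (1 - y) * (y - b)

theorem cubic_mem (i : Fin 2) (b : Ioo (0 : ℝ) 1) (y : I) : cubic i b y ∈ Icc (0 : ℝ) 1 := by
  obtain ⟨b, hb0, hb1⟩ := b
  obtain ⟨y, hy0, hy1⟩ := y
  have h : 0 ≤ y * (1 - y) := mul_nonneg hy0 (by linarith)
  fin_cases i
  · simp only [cubic, mem_Icc]
    constructor <;> nlinarith
  · simp only [cubic, mem_Icc]
    constructor <;> nlinarith

/-- The fiber map of the symbol `i`, as a self-map of `[0,1]`, for the parameters
`β 0 = β₁` and `β 1 = β₂`. -/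
noncomputable def fiberMap (β : Fin 2 → Ioo (0 : ℝ) 1) (i : Fin 2) (y : I) : I :=
  ⟨cubic i (β i) y, cubic_mem i (β i) y⟩

/-- The step skew product `(ω, y) ↦ (σ ω, g_{ω₀}(y))`. -/
noncomputable def skewPlus (β : Fin 2 → Ioo (0 : ℝ) 1) (p : SigmaPlus × I) : SigmaPlus × I :=
  (shiftPlus p.1, fiberMap β (p.1 0) p.2)

/-- The random composition `g_{ω_{n-1}} ∘ ⋯ ∘ g_{ω₀}`. -/
noncomputable def randomComp (β : Fin 2 → Ioo (0 : ℝ) 1) (ω : SigmaPlus) : ℕ → I → I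
  | 0, y => y
  | n + 1, y => fiberMap β (ω n) (randomComp β ω n y)

/-- The parameter region. -/
def GammaS : Set (ℝ × ℝ) :=
  {b | b.1 ∈ Ioo (0 : ℝ) 1 ∧ b.2 ∈ Ioo (0 : ℝ) 1 ∧
    2 - 1 / b.1 < b.2 ∧ b.2 < 1 / (1 - b.1) - 1}

/-! ### Basins and Milnor attractors -/

/-- The points whose ω-limit set under `F` is contained in `A`. -/
def omegaBasin {X : Type*} [TopologicalSpace X] (F : X → X) (A : Set X) : Set X :=
  {x | omegaLimit atTop (fun n : ℕ => F^[n]) {x} ⊆ A}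

/-- A compact invariant set whose basin has nonzero measure, such that no proper compact subset
has the same basin up to a null set. -/
structure IsMilnorAttractor {X : Type*} [TopologicalSpace X] [MeasurableSpace X]
    (μ : Measure X) (F : X → X) (A : Set X) : Prop where
  isCompact : IsCompact A
  invariant : F '' A = A
  basin_ne_zero : μ (omegaBasin F A) ≠ 0
  minimal : ∀ A' : Set X, IsCompact A' → A' ⊂ A → ¬ omegaBasin F A' =ᵐ[μ] omegaBasin F A

/-- The subset `Σ × {c}` of the phase space. -/
def level (c : I) : Set (SigmaPlus × I) := {p | p.2 = c}

/-- The distance on the phase space: the maximum of the standard distance on sequences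
(`2^{-n}`, with `n` the first index at which they differ) and the distance on `[0,1]`. -/
noncomputable def phaseDist (p q : SigmaPlus × I) : ℝ :=
  max ((PiNat.dist (E := fun _ : ℕ => Fin 2)).dist p.1 q.1) (dist p.2 q.2)

/-- The distance from a point to a (nonempty) set. -/
noncomputable def distTo (p : SigmaPlus × I) (A : Set (SigmaPlus × I)) : ℝ :=
  ⨅ q : A, phaseDist p q

/-- The basin of attraction of `A` under the step skew product. -/
def basin (β : Fin 2 → Ioo (0 : ℝ) 1) (A : Set (SigmaPlus × I)) : Set (SigmaPlus × I) :=
  {p | Tendsto (fun n : ℕ => distTo ((skewPlus β)^[n] p) A) atTop (𝓝 0)}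

end StepSkew

namespace StepSkew

open ProbabilityTheory

/-! ### The Bernoulli measures -/

/-! Near 0 the fiber maps are almost linear with slopes `1 - β 0` and `1 + β 1`, whose product is
below 1 in the region. By the strong law of large numbers random products of slightly larger slopes
tend to 0, so some positive starting point is attracted to 0 with positive probability. The symmetry
`y ↦ 1 - y` gives the same at 1.

If the parameters differ, no point is pushed up by both maps and also down by both. The set
attracted to 0 with positive probability therefore overlaps its counterpart for 1
(`exists_attracted_to_both`). From a point `z` of the overlap, monotonicity bounds the conditional
probability of convergence given any initial word from below, and the zero-one law
`ae_mem_of_forall_le` makes convergence almost sure. The separating graph is the supremum of the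
points driven to 0.

The levels are minimal because almost every base orbit is dense, so the ω-limit set of almost every
attracted point fills the whole level. -/

instance : IsProbabilityMeasure symbolMeasure := by
  unfold symbolMeasure; infer_instance

instance : IsProbabilityMeasure bernoulliPlus := by
  unfold bernoulliPlus; infer_instance

instance : IsProbabilityMeasure standardMeasure := by
  unfold standardMeasure; infer_instance

theorem symbolMeasure_singleton (i : Fin 2) : symbolMeasure {i} = 2⁻¹ := by
  rw [symbolMeasure, PMF.toMeasure_apply_singleton _ _ (measurableSet_singleton i)]
  simp

theorem integral_symbolMeasure (f : Fin 2 → ℝ) :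
    ∫ i, f i ∂symbolMeasure = (f 0 + f 1) / 2 := by
  rw [integral_fintype (Integrable.of_finite)]
  simp [Measure.real, symbolMeasure_singleton, Fin.sum_univ_two]
  ring

theorem measurePreserving_proj : MeasurePreserving proj bernoulliTwo bernoulliPlus where
  measurable := by unfold proj; fun_prop
  map_eq := Measure.map_infinitePi_infinitePi_of_inj
    (P := fun _ : ℤ => symbolMeasure) (f := fun n : ℕ => (n : ℤ)) Nat.cast_injective

/-- The sequence `ω n, ω (n + 1), …`. -/
def shiftIter (n : ℕ) (ω : SigmaPlus) : SigmaPlus := fun k => ω (k + n)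

theorem measurePreserving_shiftIter (n : ℕ) :
    MeasurePreserving (shiftIter n) bernoulliPlus bernoulliPlus where
  measurable := by unfold shiftIter; fun_prop
  map_eq := Measure.map_infinitePi_infinitePi_of_inj
    (P := fun _ : ℕ => symbolMeasure) (f := fun k : ℕ => k + n) (add_left_injective n)

/-- The first `n` symbols of `ω`, followed by `ω'`. -/
def concat (n : ℕ) (ω ω' : SigmaPlus) : SigmaPlus := fun k => if k < n then ω k else ω' (k - n)

theorem measurable_concat (n : ℕ) :
    Measurable (fun p : SigmaPlus × SigmaPlus => concat n p.1 p.2) := by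
  refine measurable_pi_lambda _ fun k => ?_
  by_cases h : k < n <;> simp only [concat, h, if_true, if_false] <;> fun_prop

theorem shiftIter_concat (n : ℕ) (ω ω' : SigmaPlus) : shiftIter n (concat n ω ω') = ω' := by
  funext k
  simp [shiftIter, concat]

theorem concat_apply_of_lt {n k : ℕ} (h : k < n) (ω ω' : SigmaPlus) : concat n ω ω' k = ω k := by
  simp [concat, h]

/-- This is the independence of the first `n` symbols from the rest: the preimage of a box is a
product of a box in the initial symbols and a shifted box in the tail. -/
theorem measurePreserving_concat (n : ℕ) :
    MeasurePreserving (fun p : SigmaPlus × SigmaPlus => concat n p.1 p.2)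
      (bernoulliPlus.prod bernoulliPlus) bernoulliPlus where
  measurable := measurable_concat n
  map_eq := by
    refine Measure.eq_infinitePi _ fun s t ht => ?_
    rw [Measure.map_apply (measurable_concat n)
      (MeasurableSet.pi s.countable_toSet fun i _ => ht i)]
    have hpre : (fun p : SigmaPlus × SigmaPlus => concat n p.1 p.2) ⁻¹' (Set.pi s t) =
        (Set.pi (s.filter (· < n)) t) ×ˢ
          (Set.pi ((s.filter (¬ · < n)).image (· - n)) fun k => t (k + n)) := by
      ext ⟨ω, ω'⟩
      simp only [Set.mem_preimage, Set.mem_pi, Finset.mem_coe, Set.mem_prod, Finset.mem_filter,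
        Finset.mem_image, concat]
      constructor
      · intro h
        refine ⟨fun i hi => by simpa [hi.2] using h i hi.1, ?_⟩
        rintro _ ⟨i, ⟨his, hin⟩, rfl⟩
        have := h i his
        rw [if_neg hin] at this
        rwa [Nat.sub_add_cancel (not_lt.1 hin)]
      · rintro ⟨h₁, h₂⟩ i hi
        by_cases hin : i < n
        · simpa [hin] using h₁ i ⟨hi, hin⟩
        · have := h₂ (i - n) ⟨i, ⟨hi, hin⟩, rfl⟩
          rw [Nat.sub_add_cancel (not_lt.1 hin)] at this
          simpa [hin] using this
    rw [hpre, Measure.prod_prod, bernoulliPlus, Measure.infinitePi_pi _ fun i _ => ht i,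
      Measure.infinitePi_pi _ fun i _ => ht (i + n), Finset.prod_image,
      ← Finset.prod_filter_mul_prod_filter_not s (· < n)]
    · congr 1
      refine Finset.prod_congr rfl fun i hi => ?_
      rw [Nat.sub_add_cancel (not_lt.1 (Finset.mem_filter.1 hi).2)]
    · intro i hi j hj hij
      simp only [Finset.coe_filter, Set.mem_ofPred_eq, not_lt] at hi hj hij
      omega

/-- Integrating the indicator of `C` over a set `E` depending on the first `n` symbols. -/
theorem mul_le_measure_inter {C E : Set SigmaPlus} (hC : MeasurableSet C) (hE : MeasurableSet E)
    {n : ℕ} (hEn : ∀ ω ω', ω ∈ E → concat n ω ω' ∈ E) {c : ENNReal}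
    (h : ∀ ω ∈ E, c ≤ bernoulliPlus {ω' | concat n ω ω' ∈ C}) :
    c * bernoulliPlus E ≤ bernoulliPlus (C ∩ E) := by
  rw [← (measurePreserving_concat n).measure_preimage (hC.inter hE).nullMeasurableSet,
    Measure.prod_apply ((measurable_concat n) (hC.inter hE)), ← setLIntegral_const,
    ← lintegral_indicator hE]
  refine lintegral_mono fun ω => ?_
  by_cases hω : ω ∈ E
  · rw [indicator_of_mem hω]
    refine (h ω hω).trans (measure_mono fun ω' h' => ⟨h', hEn ω ω' hω⟩)
  · simp [hω]

/-- A zero-one law: an event whose conditional probability given any initial word is bounded below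
by a positive constant has full measure. -/
theorem ae_mem_of_forall_le {C : Set SigmaPlus} (hC : MeasurableSet C) {c : ENNReal} (hc : c ≠ 0)
    (h : ∀ n ω, c ≤ bernoulliPlus {ω' | concat n ω ω' ∈ C}) : ∀ᵐ ω ∂bernoulliPlus, ω ∈ C := by
  have hc1 : c ≤ 1 := (h 0 default).trans prob_le_one
  have hct : c ≠ ⊤ := ne_top_of_le_ne_top ENNReal.one_ne_top hc1
  have key : ∀ E ∈ measurableCylinders (fun _ : ℕ => Fin 2),
      c * bernoulliPlus E ≤ bernoulliPlus (C ∩ E) := by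
    intro E hE
    obtain ⟨s, S, hS, rfl⟩ := (mem_measurableCylinders E).1 hE
    refine mul_le_measure_inter hC (MeasurableSet.of_mem_measurableCylinders hE) (n := s.sup id + 1) ?_
      fun ω _ => h _ ω
    intro ω ω' hω
    rw [mem_cylinder] at hω ⊢
    convert hω using 1
    funext i
    exact concat_apply_of_lt (Nat.lt_succ_of_le (Finset.le_sup (f := id) i.2)) ω ω'
  have hdense := Measure.MeasureDense.of_generateFrom_isSetAlgebra_finite bernoulliPlus
    isSetAlgebra_measurableCylinders (generateFrom_measurableCylinders (α := fun _ : ℕ => Fin 2)).symm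
  change bernoulliPlus Cᶜ = 0
  have hle : ∀ ε : ℝ, 0 < ε → c * bernoulliPlus Cᶜ ≤ 2 * ENNReal.ofReal ε := by
    intro ε hε
    -- A cylinder `E` close to `Cᶜ` meets `C` in measure at most `ε`, whereas `key` makes this
    -- intersection at least `c` times the measure of `E`.
    obtain ⟨E, hE, hlt⟩ := hdense.approx Cᶜ hC.compl (measure_ne_top _ _) ε hε
    have h1 : bernoulliPlus Cᶜ ≤ bernoulliPlus E + ENNReal.ofReal ε := by
      refine (measure_mono (t := E ∪ symmDiff Cᶜ E) fun x hx => ?_).trans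
        ((measure_union_le _ _).trans (by gcongr))
      by_cases hxE : x ∈ E
      · exact Or.inl hxE
      · exact Or.inr (Or.inl ⟨hx, hxE⟩)
    have h2 : bernoulliPlus (C ∩ E) ≤ ENNReal.ofReal ε := by
      refine (measure_mono fun x hx => ?_).trans hlt.le
      exact Or.inr ⟨hx.2, fun h => h hx.1⟩
    calc c * bernoulliPlus Cᶜ ≤ c * bernoulliPlus E + c * ENNReal.ofReal ε := by
          rw [← mul_add]; gcongr
      _ ≤ ENNReal.ofReal ε + 1 * ENNReal.ofReal ε := by
          gcongr
          exact (key E hE).trans h2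
      _ = 2 * ENNReal.ofReal ε := by ring
  have h0 : c * bernoulliPlus Cᶜ = 0 := by
    by_contra hne
    have hpos : 0 < (c * bernoulliPlus Cᶜ).toReal :=
      ENNReal.toReal_pos hne (ENNReal.mul_ne_top hct (measure_ne_top _ _))
    have := hle ((c * bernoulliPlus Cᶜ).toReal / 4) (by positivity)
    rw [← ENNReal.ofReal_toReal (ENNReal.mul_ne_top hct (measure_ne_top bernoulliPlus Cᶜ)),
      show (2 : ENNReal) = ENNReal.ofReal 2 by simp, ← ENNReal.ofReal_mul (by norm_num),
      ENNReal.ofReal_le_ofReal_iff (by positivity)] at this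
    rw [ENNReal.toReal_ofReal hpos.le] at this
    linarith
  exact (mul_eq_zero.1 h0).resolve_left hc

/-- Almost every sequence has every finite word occurring arbitrarily late. -/
theorem ae_forall_word_occurs : ∀ᵐ ω ∂bernoulliPlus, ∀ (m L : ℕ) (w : Fin L → Fin 2),
    ∃ k ≥ m, ∀ i : Fin L, ω (i + k) = w i := by
  have key : ∀ (L : ℕ) (w : Fin L → Fin 2),
      ∀ᵐ ω ∂bernoulliPlus, ω ∈ {ω : SigmaPlus | ∃ k : ℕ, ∀ i : Fin L, ω (i + k) = w i} := by
    intro L w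
    set W : Set SigmaPlus := {ω | ∀ i : Fin L, ω i = w i} with hW
    have hWpos : bernoulliPlus W ≠ 0 := by
      have hWeq : W = Set.pi (Finset.range L)
          (fun i => if h : i < L then {w ⟨i, h⟩} else univ) := by
        ext ω
        simp only [hW, Set.mem_ofPred_eq, Set.mem_pi, Finset.coe_range, Set.mem_Iio]
        constructor
        · intro h i hi
          simpa [hi] using h ⟨i, hi⟩
        · intro h i
          simpa using h i i.2
      rw [hWeq, bernoulliPlus, Measure.infinitePi_pi]
      · refine Finset.prod_ne_zero_iff.2 fun i hi => ?_
        rw [dif_pos (Finset.mem_range.1 hi), symbolMeasure_singleton]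
        simp
      · intro i _
        exact MeasurableSet.of_discrete
    -- Whatever the first `n` symbols are, the word may start at position `n`, with the same
    -- probability as at position 0.
    refine ae_mem_of_forall_le ?_ hWpos fun n ω => measure_mono fun ω' hω' => ⟨n, fun i => ?_⟩
    · have : {ω : SigmaPlus | ∃ k : ℕ, ∀ i : Fin L, ω (i + k) = w i} =
          ⋃ k : ℕ, ⋂ i : Fin L, (fun ω : SigmaPlus => ω (i + k)) ⁻¹' {w i} := by
        ext; simp
      rw [this]
      exact .iUnion fun k => .iInter fun i => (measurable_pi_apply _) (measurableSet_singleton _)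
    · have := congrFun (shiftIter_concat n ω ω') i
      simp only [shiftIter] at this
      rw [this]
      exact hω' i
  rw [ae_all_iff]; intro m
  rw [ae_all_iff]; intro L
  rw [ae_all_iff]; intro w
  filter_upwards [(measurePreserving_shiftIter m).quasiMeasurePreserving.ae (key L w)] with ω hω
  obtain ⟨k, hk⟩ := hω
  exact ⟨k + m, by omega, fun i => by simpa [shiftIter, add_assoc] using hk i⟩

/-! ### The fiber maps and their random compositions -/

variable {β : Fin 2 → Ioo (0 : ℝ) 1}

theorem continuous_fiberMap (β : Fin 2 → Ioo (0 : ℝ) 1) (i : Fin 2) :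
    Continuous (fiberMap β i) := by
  refine Continuous.subtype_mk ?_ _
  fin_cases i <;> simp only [cubic] <;> fun_prop

/-- The difference quotient is affine in `b`, so it is a convex combination of its values at `b = 0`
and `b = 1`; it is positive since these are nonnegative and not both zero. -/
theorem strictMono_fiberMap (β : Fin 2 → Ioo (0 : ℝ) 1) (i : Fin 2) :
    StrictMono (fiberMap β i) := by
  rintro ⟨x, hx0, hx1⟩ ⟨y, hy0, hy1⟩ hxy
  obtain ⟨hb0, hb1⟩ := (β i).2
  change x < y at hxy
  change cubic i (β i) x < cubic i (β i) y
  generalize (β i : ℝ) = b at hb0 hb1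
  have hxy1 : 0 < 1 - x * y := by nlinarith
  have hxy2 : 0 ≤ x + y - x * y := by nlinarith
  fin_cases i <;> simp only [cubic]
  · have h1 : 0 < 1 + ((1 + b) * (x + y) - b - x ^ 2 - x * y - y ^ 2) := by
      nlinarith [mul_pos (sub_pos.2 hb1) hxy1, mul_nonneg hb0.le hxy2,
        mul_nonneg hx0 (sub_nonneg.2 hx1), mul_nonneg hy0 (sub_nonneg.2 hy1)]
    nlinarith [mul_pos (sub_pos.2 hxy) h1]
  · have h1 : 0 < 1 - ((1 + b) * (x + y) - b - x ^ 2 - x * y - y ^ 2) := by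
      have e0 : 0 < 1 - x - y + x ^ 2 + x * y + y ^ 2 := by
        nlinarith [sq_nonneg (x + y - 2 / 3), sq_nonneg (x - y)]
      have e1 : 0 < 2 - 2 * x - 2 * y + x ^ 2 + x * y + y ^ 2 := by
        nlinarith [sq_nonneg (x + y - 4 / 3), sq_nonneg (x - y)]
      nlinarith [mul_pos (sub_pos.2 hb1) e0, mul_pos hb0 e1]
    nlinarith [mul_pos (sub_pos.2 hxy) h1]

theorem fiberMap_zero (β : Fin 2 → Ioo (0 : ℝ) 1) (i : Fin 2) : fiberMap β i 0 = 0 := by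
  apply Subtype.ext
  fin_cases i <;> simp [fiberMap, cubic]

theorem fiberMap_one (β : Fin 2 → Ioo (0 : ℝ) 1) (i : Fin 2) : fiberMap β i 1 = 1 := by
  apply Subtype.ext
  fin_cases i <;> simp [fiberMap, cubic]

theorem surjective_fiberMap (β : Fin 2 → Ioo (0 : ℝ) 1) (i : Fin 2) :
    Function.Surjective (fiberMap β i) := by
  intro z
  have := intermediate_value_univ (0 : I) 1 (continuous_fiberMap β i)
  rw [fiberMap_zero, fiberMap_one] at this
  exact this ⟨z.2.1, z.2.2⟩

theorem monotone_randomComp (β : Fin 2 → Ioo (0 : ℝ) 1) (ω : SigmaPlus) (n : ℕ) :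
    Monotone (randomComp β ω n) := by
  induction n with
  | zero => exact monotone_id
  | succ n ih => exact (strictMono_fiberMap β (ω n)).monotone.comp ih

theorem randomComp_add (β : Fin 2 → Ioo (0 : ℝ) 1) (ω : SigmaPlus) (m n : ℕ) (y : I) :
    randomComp β ω (m + n) y = randomComp β (shiftIter n ω) m (randomComp β ω n y) := by
  induction m with
  | zero => simp [randomComp]
  | succ m ih => rw [Nat.add_right_comm, randomComp, ih]; rfl

theorem randomComp_congr {ω ω' : SigmaPlus} {n : ℕ} (h : ∀ k < n, ω k = ω' k) (y : I) :
    randomComp β ω n y = randomComp β ω' n y := by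
  induction n with
  | zero => rfl
  | succ n ih => rw [randomComp, randomComp, ih fun k hk => h k (by omega), h n (by omega)]

theorem measurable_randomComp (β : Fin 2 → Ioo (0 : ℝ) 1) (n : ℕ) :
    Measurable (fun p : SigmaPlus × I => randomComp β p.1 n p.2) := by
  induction n with
  | zero => exact measurable_snd
  | succ n ih =>
    have h : Measurable (fun q : Fin 2 × I => fiberMap β q.1 q.2) :=
      measurable_from_prod_countable_right fun i => (continuous_fiberMap β i).measurable
    exact h.comp (((measurable_pi_apply n).comp measurable_fst).prodMk ih)

/-- The points of the phase space whose second coordinate tends to `c`. -/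
def convSet (β : Fin 2 → Ioo (0 : ℝ) 1) (c : I) : Set (SigmaPlus × I) :=
  {p | Tendsto (fun n => randomComp β p.1 n p.2) atTop (𝓝 c)}

theorem measurableSet_convSet (c : I) : MeasurableSet (convSet β c) :=
  measurableSet_tendsto _ (measurable_randomComp β)

/-- The sequences along which `y` is driven to `c`. -/
def convSeq (β : Fin 2 → Ioo (0 : ℝ) 1) (c y : I) : Set SigmaPlus :=
  {ω | Tendsto (fun n => randomComp β ω n y) atTop (𝓝 c)}

theorem measurableSet_convSeq (c y : I) : MeasurableSet (convSeq β c y) :=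
  (measurableSet_convSet (β := β) c).preimage (measurable_id.prodMk measurable_const)

theorem mem_convSeq_iff_shiftIter {c y : I} {ω : SigmaPlus} (n : ℕ) :
    ω ∈ convSeq β c y ↔ shiftIter n ω ∈ convSeq β c (randomComp β ω n y) := by
  change Tendsto _ _ _ ↔ Tendsto _ _ _
  simp_rw [← randomComp_add]
  exact (tendsto_add_atTop_iff_nat n).symm

/-- Markov property: given the first `n` symbols, only the position reached after `n` steps matters.
-/
theorem concat_mem_convSeq {c y : I} {n : ℕ} {ω ω' : SigmaPlus} :
    concat n ω ω' ∈ convSeq β c y ↔ ω' ∈ convSeq β c (randomComp β ω n y) := by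
  rw [mem_convSeq_iff_shiftIter n, shiftIter_concat,
    randomComp_congr fun k hk => concat_apply_of_lt hk ω ω']

theorem convSeq_zero_anti {y z : I} (h : y ≤ z) : convSeq β 0 z ⊆ convSeq β 0 y := fun ω hω =>
  tendsto_of_tendsto_of_tendsto_of_le_of_le tendsto_const_nhds hω
    (fun _ => unitInterval.nonneg') fun n => monotone_randomComp β ω n h

theorem convSeq_one_mono {y z : I} (h : y ≤ z) : convSeq β 1 y ⊆ convSeq β 1 z := fun ω hω =>
  tendsto_of_tendsto_of_tendsto_of_le_of_le hω tendsto_const_nhds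
    (fun n => monotone_randomComp β ω n h) fun _ => unitInterval.le_one'

/-! ### The symmetry `y ↦ 1 - y` -/

/-- The parameters `1 - β`. -/
def flip (β : Fin 2 → Ioo (0 : ℝ) 1) : Fin 2 → Ioo (0 : ℝ) 1 :=
  fun i => ⟨1 - β i, by linarith [(β i).2.2], by linarith [(β i).2.1]⟩

theorem fiberMap_flip (i : Fin 2) (y : I) :
    fiberMap (flip β) i (σ y) = σ (fiberMap β i y) := by
  apply Subtype.ext
  fin_cases i <;> simp [fiberMap, cubic, flip] <;> ring

theorem randomComp_flip (ω : SigmaPlus) (n : ℕ) (y : I) :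
    randomComp (flip β) ω n (σ y) = σ (randomComp β ω n y) := by
  induction n with
  | zero => rfl
  | succ n ih => rw [randomComp, ih, fiberMap_flip]; rfl

theorem convSeq_flip_zero (y : I) : convSeq (flip β) 0 (σ y) = convSeq β 1 y := by
  ext ω
  change Tendsto _ _ _ ↔ Tendsto _ _ _
  simp_rw [randomComp_flip]
  constructor
  · intro h
    simpa [Function.comp_def] using (unitInterval.continuous_symm.tendsto 0).comp h
  · intro h
    simpa [Function.comp_def] using (unitInterval.continuous_symm.tendsto 1).comp h

/-! ### Contraction near the end points -/

/-- A negative normal exponent at `0` yields points attracted to `0` with positive probability. -/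
theorem exists_measure_convSeq_zero_ne_zero (hneg : (1 - (β 0 : ℝ)) * (1 + β 1) < 1) :
    ∃ y : I, 0 < y ∧ bernoulliPlus (convSeq β 0 y) ≠ 0 := by
  -- The slopes at 0 are enlarged by `2 * δ` so that they bound the maps linearly on `[0, δ]`, while
  -- their product stays below 1.
  obtain ⟨δ, hδ1, hδ, hδ0⟩ : ∃ δ : ℝ, δ < 1 ∧
      (1 - (β 0 : ℝ) + 2 * δ) * (1 + β 1 + 2 * δ) < 1 ∧ 0 < δ := by
    have h1 : ∀ᶠ δ : ℝ in 𝓝 0, δ < 1 := Iio_mem_nhds one_pos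
    have h2 : ∀ᶠ δ : ℝ in 𝓝 0, (1 - (β 0 : ℝ) + 2 * δ) * (1 + β 1 + 2 * δ) < 1 := by
      have hc : Continuous fun δ : ℝ => (1 - (β 0 : ℝ) + 2 * δ) * (1 + β 1 + 2 * δ) := by fun_prop
      exact hc.continuousAt.eventually_lt continuousAt_const (by simpa using hneg)
    obtain ⟨δ, hδ, h0⟩ := (((h1.and h2).filter_mono nhdsWithin_le_nhds).and
      (self_mem_nhdsWithin (s := Ioi (0 : ℝ)))).exists
    exact ⟨δ, hδ.1, hδ.2, h0⟩
  obtain ⟨hb0, hb0'⟩ := (β 0).2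
  obtain ⟨hb1, hb1'⟩ := (β 1).2
  let a : Fin 2 → ℝ := ![1 - β 0 + 2 * δ, 1 + β 1 + 2 * δ]
  have ha0 : a 0 = 1 - β 0 + 2 * δ := rfl
  have ha1 : a 1 = 1 + β 1 + 2 * δ := rfl
  have hapos : ∀ i, 0 < a i := by
    intro i
    fin_cases i
    · change 0 < 1 - (β 0 : ℝ) + 2 * δ; linarith
    · change 0 < 1 + (β 1 : ℝ) + 2 * δ; linarith
  have hstep : ∀ (i : Fin 2) (y : I), (y : ℝ) ≤ δ → (fiberMap β i y : ℝ) ≤ a i * y := by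
    intro i ⟨y, hy0, hy1⟩ hy
    change y ≤ δ at hy
    fin_cases i
    · change y + y * (1 - y) * (y - β 0) ≤ (1 - β 0 + 2 * δ) * y
      have : 1 + (1 - y) * (y - β 0) ≤ 1 - β 0 + 2 * δ := by nlinarith
      nlinarith [mul_le_mul_of_nonneg_right this hy0]
    · change y - y * (1 - y) * (y - β 1) ≤ (1 + β 1 + 2 * δ) * y
      have : 1 - (1 - y) * (y - β 1) ≤ 1 + β 1 + 2 * δ := by nlinarith
      nlinarith [mul_le_mul_of_nonneg_right this hy0]
  have hprod : ∀ᵐ ω ∂bernoulliPlus,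
      Tendsto (fun n => ∏ k ∈ Finset.range n, a (ω k)) atTop (𝓝 0) := by
    have hmp : ∀ n : ℕ, MeasurePreserving (fun ω : SigmaPlus => ω n) bernoulliPlus symbolMeasure :=
      fun n => measurePreserving_eval_infinitePi (fun _ : ℕ => symbolMeasure) n
    have hlog : Measurable fun i => Real.log (a i) := measurable_of_finite _
    have hint : ∫ ω, Real.log (a (ω 0)) ∂bernoulliPlus < 0 := by
      have h := integral_map (μ := bernoulliPlus) (hmp 0).measurable.aemeasurable
        (f := fun i => Real.log (a i)) hlog.aestronglyMeasurable
      rw [(hmp 0).map_eq, integral_symbolMeasure, ← Real.log_mul (hapos 0).ne' (hapos 1).ne'] at h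
      rw [← h]
      have := Real.log_neg (mul_pos (hapos 0) (hapos 1)) hδ
      linarith
    have hindep : iIndepFun (fun (n : ℕ) (ω : SigmaPlus) => Real.log (a (ω n))) bernoulliPlus :=
      iIndepFun_infinitePi (P := fun _ : ℕ => symbolMeasure)
        (X := fun _ i => Real.log (a i)) fun _ => hlog
    have hslln := strong_law_ae_real (μ := bernoulliPlus)
      (fun (n : ℕ) (ω : SigmaPlus) => Real.log (a (ω n)))
      ((hmp 0).integrable_comp_of_integrable (Integrable.of_finite (f := fun i => Real.log (a i))))
      (fun i j hij => hindep.indepFun hij)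
      (fun n => ((⟨(hmp n).measurable.aemeasurable, (hmp 0).measurable.aemeasurable,
        by rw [(hmp n).map_eq, (hmp 0).map_eq]⟩ : IdentDistrib (fun ω : SigmaPlus => ω n)
          (fun ω : SigmaPlus => ω 0) bernoulliPlus bernoulliPlus).comp hlog))
    filter_upwards [hslln] with ω hω
    have hbot := (hω.neg_mul_atTop hint (tendsto_natCast_atTop_atTop (R := ℝ)))
    refine (Real.tendsto_exp_atBot.comp hbot).congr' ?_
    filter_upwards [eventually_gt_atTop 0] with n hn
    simp only [Function.comp_apply]
    rw [div_mul_cancel₀ _ (by positivity), Real.exp_sum]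
    exact Finset.prod_congr rfl fun k _ => Real.exp_log (hapos _)
  -- Convergent products are bounded, so a single bound `M` works with positive probability.
  -- Starting at `δ / (M + 1)` then keeps the orbit in `[0, δ]`, where the linear bound applies.
  obtain ⟨M, hM⟩ : ∃ M : ℕ, bernoulliPlus {ω : SigmaPlus |
      Tendsto (fun n => ∏ k ∈ Finset.range n, a (ω k)) atTop (𝓝 0) ∧
      ∀ n, ∏ k ∈ Finset.range n, a (ω k) ≤ M} ≠ 0 := by
    by_contra! hall
    have hnull := measure_iUnion_null hall
    have : ∀ᵐ ω ∂bernoulliPlus, False := by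
      filter_upwards [hprod, compl_mem_ae_iff.2 hnull] with ω h1 h2
      obtain ⟨B, hB⟩ := h1.bddAbove_range
      obtain ⟨M, hBM⟩ := exists_nat_ge B
      exact h2 (mem_iUnion.2 ⟨M, h1, fun n => (hB (mem_range_self n)).trans hBM⟩)
    simpa using this.exists
  have hM1 : (0 : ℝ) < M + 1 := by positivity
  have hy01 : δ / (M + 1) ≤ 1 := (div_le_one hM1).2 (by linarith [Nat.cast_nonneg (α := ℝ) M])
  refine ⟨⟨δ / (M + 1), by positivity, hy01⟩, ?_, fun h0 => hM (measure_mono_null ?_ h0)⟩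
  · change (0 : ℝ) < δ / (M + 1)
    positivity
  rintro ω ⟨hω, hωM⟩
  set y : I := ⟨δ / (M + 1), by positivity, hy01⟩ with hy
  have hbound : ∀ n, (randomComp β ω n y : ℝ) ≤ (∏ k ∈ Finset.range n, a (ω k)) * y := by
    intro n
    induction n with
    | zero => simp [randomComp]
    | succ n ih =>
      have hle : (randomComp β ω n y : ℝ) ≤ δ := by
        refine ih.trans ((mul_le_mul_of_nonneg_right (hωM n) y.2.1).trans ?_)
        change M * (δ / (M + 1)) ≤ δ
        rw [mul_div_assoc', div_le_iff₀ hM1]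
        nlinarith
      rw [randomComp, Finset.prod_range_succ]
      refine (hstep _ _ hle).trans ?_
      nlinarith [mul_le_mul_of_nonneg_left ih (hapos (ω n)).le]
  change Tendsto _ _ _
  rw [tendsto_subtype_rng]
  refine squeeze_zero (fun n => (randomComp β ω n y).2.1) hbound ?_
  simpa using hω.mul_const (y : ℝ)

/-! ### Overlap of the two attraction ranges -/

theorem measure_convSeq_ne_zero_of_fiberMap {c y : I} (i : Fin 2)
    (h : bernoulliPlus (convSeq β c (fiberMap β i y)) ≠ 0) :
    bernoulliPlus (convSeq β c y) ≠ 0 := by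
  have hmp : MeasurePreserving (fun ω : SigmaPlus => ω 0) bernoulliPlus symbolMeasure :=
    measurePreserving_eval_infinitePi (fun _ : ℕ => symbolMeasure) 0
  have hE : bernoulliPlus ((fun ω : SigmaPlus => ω 0) ⁻¹' {i}) = 2⁻¹ := by
    rw [hmp.measure_preimage (measurableSet_singleton i).nullMeasurableSet,
      symbolMeasure_singleton]
  have key := mul_le_measure_inter (measurableSet_convSeq (β := β) c y)
    (E := (fun ω : SigmaPlus => ω 0) ⁻¹' {i}) (hmp.measurable (measurableSet_singleton i)) (n := 1)
    (fun ω ω' hω => by simpa [concat] using hω)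
    (c := bernoulliPlus (convSeq β c (fiberMap β i y))) (fun ω hω => by
      have hω' : ω 0 = i := hω
      simp only [concat_mem_convSeq, randomComp, hω']
      exact le_rfl)
  intro h0
  rw [measure_mono_null inter_subset_left h0, hE] at key
  exact mul_ne_zero h (by simp) (le_zero_iff.1 key)

/-- The threshold below which a point is attracted to `0` with positive probability is `1`
unless both fiber maps move it up. -/
theorem sSup_measure_convSeq_zero (hneg : (1 - (β 0 : ℝ)) * (1 + β 1) < 1) :
    0 < sSup {y : I | bernoulliPlus (convSeq β 0 y) ≠ 0} ∧
    (sSup {y : I | bernoulliPlus (convSeq β 0 y) ≠ 0} = 1 ∨ (β 0 : ℝ) ≤ β 1) := by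
  set Z := {y : I | bernoulliPlus (convSeq β 0 y) ≠ 0} with hZ
  have hlower : ∀ {y z : I}, y ≤ z → z ∈ Z → y ∈ Z := fun hyz hz h0 =>
    hz (measure_mono_null (convSeq_zero_anti hyz) h0)
  obtain ⟨y₀, hy₀, hy₀Z⟩ := exists_measure_convSeq_zero_ne_zero hneg
  have hs0 : 0 < sSup Z := hy₀.trans_le (le_sSup hy₀Z)
  refine ⟨hs0, or_iff_not_imp_left.2 fun hs1 => ?_⟩
  have hs1' : sSup Z < 1 := lt_of_le_of_ne unitInterval.le_one' hs1
  -- If a map moved the supremum down, it would also move slightly larger points below the supremum,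
  -- putting them in `Z`.
  have hup : ∀ i, sSup Z ≤ fiberMap β i (sSup Z) := by
    intro i
    by_contra! hlt
    have hev : ∀ᶠ y in 𝓝[>] (sSup Z), fiberMap β i y < sSup Z :=
      ((continuous_fiberMap β i).continuousAt.eventually_lt continuousAt_const hlt).filter_mono
        nhdsWithin_le_nhds
    have : (𝓝[>] (sSup Z)).NeBot := nhdsGT_neBot_of_exists_gt ⟨1, hs1'⟩
    obtain ⟨y, hy, hgt⟩ := (hev.and self_mem_nhdsWithin).exists
    obtain ⟨z, hz, hyz⟩ := lt_sSup_iff.1 hy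
    exact not_lt_of_ge (le_sSup (measure_convSeq_ne_zero_of_fiberMap i (hlower hyz.le hz))) hgt
  have h0 := hup 0
  have h1 := hup 1
  generalize sSup Z = s at *
  obtain ⟨s, hs⟩ := s
  change (0 : ℝ) < s at hs0
  change s < (1 : ℝ) at hs1'
  change s ≤ s + s * (1 - s) * (s - β 0) at h0
  change s ≤ s - s * (1 - s) * (s - β 1) at h1
  have hpos : 0 < s * (1 - s) := mul_pos hs0 (by linarith)
  have e0 : 0 ≤ s - β 0 := nonneg_of_mul_nonneg_right (by linarith) hpos
  have e1 : 0 ≤ β 1 - s := nonneg_of_mul_nonneg_right (by linarith) hpos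
  linarith

/-- The thresholds for 0 and 1 are `s` and `σ t`. They overlap if `s = 1` or `t = 1`; otherwise `β 0
≤ β 1` and, by the symmetry, `β 1 ≤ β 0`. -/
theorem exists_attracted_to_both (h0 : (1 - (β 0 : ℝ)) * (1 + β 1) < 1)
    (h1 : (β 0 : ℝ) * (2 - β 1) < 1) (hne : β 0 ≠ β 1) :
    ∃ y : I, bernoulliPlus (convSeq β 0 y) ≠ 0 ∧ bernoulliPlus (convSeq β 1 y) ≠ 0 := by
  obtain ⟨hs, hs'⟩ := sSup_measure_convSeq_zero h0
  obtain ⟨ht, ht'⟩ := sSup_measure_convSeq_zero (β := flip β) (by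
    change (1 - (1 - (β 0 : ℝ))) * (1 + (1 - β 1)) < 1
    linarith)
  set s := sSup {y : I | bernoulliPlus (convSeq β 0 y) ≠ 0}
  set t := sSup {y : I | bernoulliPlus (convSeq (flip β) 0 y) ≠ 0}
  have hst : σ t < s := by
    rcases hs' with hs' | hs'
    · rw [hs']
      change 1 - (t : ℝ) < 1
      have : (0 : ℝ) < t := ht
      linarith
    rcases ht' with ht' | ht'
    · rw [ht']; simpa using hs
    · change 1 - (β 0 : ℝ) ≤ 1 - β 1 at ht'
      exact absurd (Subtype.ext (le_antisymm hs' (by linarith))) hne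
  obtain ⟨z, hz, htz⟩ := lt_sSup_iff.1 hst
  have hzt : σ z < t := by
    change 1 - (z : ℝ) < t
    have : 1 - (t : ℝ) < z := htz
    linarith
  obtain ⟨w, hw, hzw⟩ := lt_sSup_iff.1 hzt
  refine ⟨z, hz, fun h => hw (measure_mono_null (convSeq_zero_anti hzw.le) ?_)⟩
  rwa [convSeq_flip_zero]

/-- If the parameters differ, almost every orbit tends to one of the end points. -/
theorem ae_mem_convSeq (h0 : (1 - (β 0 : ℝ)) * (1 + β 1) < 1)
    (h1 : (β 0 : ℝ) * (2 - β 1) < 1) (hne : β 0 ≠ β 1) (y : I) :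
    ∀ᵐ ω ∂bernoulliPlus, ω ∈ convSeq β 0 y ∪ convSeq β 1 y := by
  obtain ⟨z, hz0, hz1⟩ := exists_attracted_to_both h0 h1 hne
  refine ae_mem_of_forall_le ((measurableSet_convSeq 0 y).union (measurableSet_convSeq 1 y))
    (c := min (bernoulliPlus (convSeq β 0 z)) (bernoulliPlus (convSeq β 1 z))) ?_ fun n ω => ?_
  · rcases min_choice (bernoulliPlus (convSeq β 0 z)) (bernoulliPlus (convSeq β 1 z)) with h | h <;>
      rw [h] <;> assumption
  -- After any initial word the orbit is on one side of `z`, and is at least as likely as `z` to be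
  -- attracted to the end point on that side.
  · rcases le_total (randomComp β ω n y) z with h | h
    · exact (min_le_left _ _).trans (measure_mono fun ω' hω' =>
        Or.inl (concat_mem_convSeq.2 (convSeq_zero_anti h hω')))
    · exact (min_le_right _ _).trans (measure_mono fun ω' hω' =>
        Or.inr (concat_mem_convSeq.2 (convSeq_one_mono h hω')))

/-! ### Basins -/

theorem skewPlus_iterate (β : Fin 2 → Ioo (0 : ℝ) 1) (n : ℕ) (p : SigmaPlus × I) :
    (skewPlus β)^[n] p = (shiftIter n p.1, randomComp β p.1 n p.2) := by
  induction n with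
  | zero => rfl
  | succ n ih =>
    rw [Function.iterate_succ_apply', ih]
    refine Prod.ext ?_ ?_
    · funext k
      simp [skewPlus, shiftPlus, shiftIter, add_assoc, add_comm 1]
    · simp [skewPlus, shiftIter, randomComp]

theorem distTo_level (p : SigmaPlus × I) (c : I) : distTo p (level c) = dist p.2 c := by
  have hlb : ∀ q : level c, dist p.2 c ≤ phaseDist p q := by
    rintro ⟨q, rfl⟩
    exact le_max_right _ _
  refine le_antisymm ?_ ?_
  · refine (ciInf_le ⟨_, forall_mem_range.2 hlb⟩ ⟨(p.1, c), rfl⟩).trans ?_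
    simp [phaseDist, PiNat.dist_self]
  · have : Nonempty (level c) := ⟨⟨(p.1, c), rfl⟩⟩
    exact le_ciInf hlb

theorem basin_level (c : I) : basin β (level c) = convSet β c := by
  ext p
  change Tendsto _ _ _ ↔ Tendsto _ _ _
  simp_rw [distTo_level, skewPlus_iterate]
  exact tendsto_iff_dist_tendsto_zero.symm

theorem standardMeasure_convSet (c : I) :
    standardMeasure (convSet β c) = ∫⁻ y, bernoulliPlus (convSeq β c y) := by
  rw [standardMeasure, Measure.prod_apply_symm (measurableSet_convSet c)]
  rfl

theorem standardMeasure_convSet_zero_pos (hneg : (1 - (β 0 : ℝ)) * (1 + β 1) < 1) :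
    0 < standardMeasure (convSet β 0) := by
  obtain ⟨y₀, hy₀, hne⟩ := exists_measure_convSeq_zero_ne_zero hneg
  rw [standardMeasure_convSet]
  calc 0 < bernoulliPlus (convSeq β 0 y₀) * volume (Iic y₀) := by
        refine ENNReal.mul_pos hne ?_
        rw [unitInterval.volume_Iic]
        exact (ENNReal.ofReal_pos.2 hy₀).ne'
    _ ≤ ∫⁻ y, bernoulliPlus (convSeq β 0 y) := by
        rw [← setLIntegral_const]
        exact (setLIntegral_mono' measurableSet_Iic fun y hy =>
          measure_mono (convSeq_zero_anti hy)).trans (setLIntegral_le_lintegral _ _)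

theorem standardMeasure_convSet_one_pos (hneg : (β 0 : ℝ) * (2 - β 1) < 1) :
    0 < standardMeasure (convSet β 1) := by
  have h := standardMeasure_convSet_zero_pos (β := flip β) (by
    change (1 - (1 - (β 0 : ℝ))) * (1 + (1 - β 1)) < 1
    linarith)
  rw [standardMeasure_convSet] at h ⊢
  rw [← unitInterval.measurePreserving_symm.lintegral_comp_emb
    unitInterval.symmMeasurableEquiv.measurableEmbedding] at h
  simpa only [convSeq_flip_zero] using h

/-! ### The levels as Milnor attractors -/

theorem convSet_subset_omegaBasin (c : I) :
    convSet β c ⊆ omegaBasin (skewPlus β) (level c) := by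
  intro p hp q hq
  rw [mem_omegaLimit_singleton_iff_mapClusterPt] at hq
  have h2 : MapClusterPt q.2 atTop fun n => randomComp β p.1 n p.2 := by
    have := hq.continuousAt_comp continuous_snd.continuousAt
    simpa [Function.comp_def, skewPlus_iterate] using this
  obtain ⟨φ, hφ, hlim⟩ := h2.tendsto_subseq
  exact tendsto_nhds_unique hlim (Tendsto.comp hp hφ.tendsto_atTop)

/-- The fiber coordinate converges to `c`, while arbitrarily late the base orbit begins with any
prescribed initial word of `x`. -/
theorem mem_omegaLimit_of_word_occurs {c : I} {p : SigmaPlus × I} (hp : p ∈ convSet β c)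
    (hword : ∀ (m L : ℕ) (w : Fin L → Fin 2), ∃ k ≥ m, ∀ i : Fin L, p.1 (i + k) = w i)
    (x : SigmaPlus) : (x, c) ∈ omegaLimit atTop (fun n : ℕ => (skewPlus β)^[n]) {p} := by
  rw [mem_omegaLimit_singleton_iff_mapClusterPt, mapClusterPt_iff_frequently]
  intro U hU
  obtain ⟨V, hV, W, hW, hVW⟩ := mem_nhds_prod_iff.1 hU
  obtain ⟨_, ⟨x', L, rfl⟩, hx, hL⟩ :=
    (PiNat.isTopologicalBasis_cylinders fun _ : ℕ => Fin 2).mem_nhds_iff.1 hV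
  rw [← PiNat.mem_cylinder_iff_eq.1 hx] at hL
  obtain ⟨N, hN⟩ := eventually_atTop.1 (hp.eventually_mem hW)
  refine frequently_atTop.2 fun m => ?_
  obtain ⟨k, hk, hkw⟩ := hword (max m N) L fun i => x i
  refine ⟨k, (le_max_left _ _).trans hk, hVW ?_⟩
  rw [skewPlus_iterate]
  exact ⟨hL fun i hi => hkw ⟨i, hi⟩, hN k ((le_max_right _ _).trans hk)⟩

theorem image_skewPlus_level {c : I} (hc : ∀ i, fiberMap β i c = c) :
    skewPlus β '' level c = level c := by
  ext ⟨ω, y⟩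
  constructor
  · rintro ⟨⟨ω', y'⟩, rfl, h⟩
    rw [← h]
    exact hc _
  · rintro rfl
    exact ⟨(concat 1 ω ω, y), rfl, Prod.ext (by funext k; simp [skewPlus, shiftPlus, concat])
      (hc _)⟩

/-- If a proper subset misses a point of the level, almost every point of `convSet β c` has that
point in its ω-limit set and so leaves the basin, a loss of positive measure. -/
theorem isMilnorAttractor_level {c : I} (hc : ∀ i, fiberMap β i c = c)
    (hpos : 0 < standardMeasure (convSet β c)) :
    IsMilnorAttractor standardMeasure (skewPlus β) (level c) where
  isCompact := (isClosed_eq continuous_snd continuous_const).isCompact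
  invariant := image_skewPlus_level hc
  basin_ne_zero := (hpos.trans_le (measure_mono (convSet_subset_omegaBasin c))).ne'
  minimal := by
    intro A' _ hA' heq
    obtain ⟨⟨x, z⟩, hz, hx⟩ := exists_of_ssubset hA'
    obtain rfl : z = c := hz
    have hword : ∀ᵐ p ∂standardMeasure, ∀ (m L : ℕ) (w : Fin L → Fin 2),
        ∃ k ≥ m, ∀ i : Fin L, p.1 (i + k) = w i :=
      Measure.quasiMeasurePreserving_fst.ae ae_forall_word_occurs
    refine hpos.ne' (measure_eq_zero_iff_ae_notMem.2 ?_)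
    filter_upwards [hword, heq.mem_iff] with p hp hiff hconv
    exact hx (hiff.2 (convSet_subset_omegaBasin z hconv)
      (mem_omegaLimit_of_word_occurs hconv hp x))

/-! ### The separating graph -/

/-- The threshold below which points are driven to `0`. -/
noncomputable def separator (β : Fin 2 → Ioo (0 : ℝ) 1) (ω : SigmaPlus) : I :=
  sSup {y | ω ∈ convSeq β 0 y}

/-- As being driven to 0 passes to smaller points, a countable dense set of candidates detects the
supremum. -/
theorem measurable_separator : Measurable (separator β) := by
  refine measurable_of_Ioi fun a => ?_
  obtain ⟨D, hDc, hD⟩ := TopologicalSpace.exists_countable_dense I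
  have : separator β ⁻¹' Ioi a = ⋃ y ∈ {y : I | a < y ∧ y ∈ D ∪ {1}}, convSeq β 0 y := by
    ext ω
    simp only [mem_preimage, mem_Ioi, separator, lt_sSup_iff, mem_iUnion, exists_prop]
    constructor
    · rintro ⟨z, hz, haz⟩
      obtain ⟨y, hyD, hy⟩ := hD.exists_between haz
      exact ⟨y, ⟨hy.1, Or.inl hyD⟩, convSeq_zero_anti hy.2.le hz⟩
    · rintro ⟨y, hy, hω⟩
      exact ⟨y, hω, hy.1⟩
  rw [this]
  exact MeasurableSet.biUnion ((hDc.union (countable_singleton 1)).mono fun y hy => hy.2)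
    fun y _ => measurableSet_convSeq 0 y

/-- The fiber map is an order isomorphism, so it commutes with suprema. This gives invariance for
every sequence, without an exceptional set. -/
theorem separator_shiftPlus (ω : SigmaPlus) :
    separator β (shiftPlus ω) = fiberMap β (ω 0) (separator β ω) := by
  let e : I ≃o I := (strictMono_fiberMap β (ω 0)).orderIsoOfSurjective _
    (surjective_fiberMap β (ω 0))
  change _ = e (separator β ω)
  rw [separator, separator, e.map_sSup, ← sSup_image]
  congr 1
  ext z
  obtain ⟨y, rfl⟩ := e.surjective z
  rw [e.injective.mem_set_image]
  exact (mem_convSeq_iff_shiftIter 1).symm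

theorem mem_convSeq_zero_of_lt_separator {ω : SigmaPlus} {y : I} (h : y < separator β ω) :
    ω ∈ convSeq β 0 y := by
  obtain ⟨z, hz, hyz⟩ := lt_sSup_iff.1 h
  exact convSeq_zero_anti hyz.le hz

/-- An interval above the separator has positive length, so it contains a point with a limit at 0 or
1. The limit is not 0, and monotonicity carries 1 upwards. -/
theorem mem_convSeq_one_of_separator_lt {ω : SigmaPlus}
    (hω : ∀ᵐ y : I, ω ∈ convSeq β 0 y ∪ convSeq β 1 y) {y : I} (h : separator β ω < y) :
    ω ∈ convSeq β 1 y := by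
  have hvol : volume (Ioo (separator β ω) y) ≠ 0 := by
    rw [unitInterval.volume_Ioo]
    exact (ENNReal.ofReal_pos.2 (sub_pos.2 h)).ne'
  obtain ⟨z, hz, hzω⟩ := (frequently_ae_mem_iff.2 hvol).and_eventually hω |>.exists
  refine hzω.elim (fun h0 => absurd hz.1 (not_lt_of_ge (le_sSup h0))) fun h1 => ?_
  exact convSeq_one_mono hz.2.le h1

theorem ae_mem_convSet_union (h0 : (1 - (β 0 : ℝ)) * (1 + β 1) < 1)
    (h1 : (β 0 : ℝ) * (2 - β 1) < 1) (hne : β 0 ≠ β 1) :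
    ∀ᵐ p ∂standardMeasure, p ∈ convSet β 0 ∪ convSet β 1 := by
  have hmeas : MeasurableSet (convSet β 0 ∪ convSet β 1) :=
    (measurableSet_convSet 0).union (measurableSet_convSet 1)
  change standardMeasure (convSet β 0 ∪ convSet β 1)ᶜ = 0
  rw [standardMeasure, Measure.prod_apply_symm hmeas.compl]
  exact lintegral_eq_zero_of_ae_eq_zero (.of_forall fun y => ae_mem_convSeq h0 h1 hne y)

/-- The products are those of the slopes at 0 and at 1, so these are the negative normal exponents
without logarithms. -/
theorem mul_lt_one_of_mem_GammaS {b : ℝ × ℝ} (h : b ∈ GammaS) :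
    (1 - b.1) * (1 + b.2) < 1 ∧ b.1 * (2 - b.2) < 1 := by
  obtain ⟨⟨h0, h1⟩, -, h2, h3⟩ := h
  constructor
  · rw [lt_sub_iff_add_lt, lt_div_iff₀ (by linarith)] at h3
    linarith
  · rw [sub_lt_comm, lt_div_iff₀ h0] at h2
    linarith

end StepSkew

theorem theorem4p2 (β₁ β₂ : Set.Ioo (0 : ℝ) 1)
    (hβ : ((β₁ : ℝ), (β₂ : ℝ)) ∈ StepSkew.GammaS) :
    (StepSkew.IsMilnorAttractor StepSkew.standardMeasure
        (StepSkew.skewPlus ![β₁, β₂]) (StepSkew.level 0) ∧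
      StepSkew.IsMilnorAttractor StepSkew.standardMeasure
        (StepSkew.skewPlus ![β₁, β₂]) (StepSkew.level 1)) ∧
    (0 < StepSkew.standardMeasure (StepSkew.basin ![β₁, β₂] (StepSkew.level 0)) ∧
      0 < StepSkew.standardMeasure (StepSkew.basin ![β₁, β₂] (StepSkew.level 1))) ∧
    (β₁ ≠ β₂ →
      (∀ᵐ p ∂StepSkew.standardMeasure,
        p ∈ StepSkew.basin ![β₁, β₂] (StepSkew.level 0) ∪
          StepSkew.basin ![β₁, β₂] (StepSkew.level 1)) ∧
      ∃ ψ : StepSkew.SigmaTwo → unitInterval, Measurable ψ ∧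
        (∀ ω : StepSkew.SigmaTwo,
          ψ (StepSkew.shiftTwo ω) = StepSkew.fiberMap ![β₁, β₂] (ω 0) (ψ ω)) ∧
        ∀ᵐ ω ∂StepSkew.bernoulliTwo, ∀ y : unitInterval,
          (y < ψ ω → Filter.Tendsto
            (fun n => StepSkew.randomComp ![β₁, β₂] (StepSkew.proj ω) n y)
              Filter.atTop (nhds 0)) ∧
          (ψ ω < y → Filter.Tendsto
            (fun n => StepSkew.randomComp ![β₁, β₂] (StepSkew.proj ω) n y)
              Filter.atTop (nhds 1))) := by

  obtain ⟨h0, h1⟩ := StepSkew.mul_lt_one_of_mem_GammaS hβ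
  have hpos0 := StepSkew.standardMeasure_convSet_zero_pos (β := ![β₁, β₂]) h0
  have hpos1 := StepSkew.standardMeasure_convSet_one_pos (β := ![β₁, β₂]) h1
  simp only [StepSkew.basin_level]
  refine ⟨⟨StepSkew.isMilnorAttractor_level (StepSkew.fiberMap_zero _) hpos0,
    StepSkew.isMilnorAttractor_level (StepSkew.fiberMap_one _) hpos1⟩, ⟨hpos0, hpos1⟩,
    fun hne => ?_⟩
  have hae := StepSkew.ae_mem_convSet_union (β := ![β₁, β₂]) h0 h1 hne
  refine ⟨hae, fun ω => StepSkew.separator ![β₁, β₂] (StepSkew.proj ω),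
    StepSkew.measurable_separator.comp StepSkew.measurePreserving_proj.measurable,
    fun ω => StepSkew.separator_shiftPlus (StepSkew.proj ω), ?_⟩
  -- Fubini gives, for almost every one-sided sequence, convergence for almost every `y`; this pulls
  -- back along the projection.
  filter_upwards [StepSkew.measurePreserving_proj.quasiMeasurePreserving.ae
    (MeasureTheory.Measure.ae_ae_of_ae_prod hae)] with ω hω y
  exact ⟨StepSkew.mem_convSeq_zero_of_lt_separator,
    StepSkew.mem_convSeq_one_of_separator_lt hω⟩
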